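/- For $n\ge 1$ let $\lambda$ be the Lebesgue measure on $n^\omega$, i.e. $\lambda(\llbracket\sigma\rrbracket)=n^{-|\sigma|}$ for every finite string $\sigma$ over $\{0,\dots,n-1\}$, where $\llbracket\sigma\rrbracket$ is the set of all sequences in $n^\omega$ extending $\sigma$. A sequence $x\in 3^\omega$ is Martin-Löf random if $x\notin\bigcap_i U_i$ for every uniformly $\Sigma^0_1$ sequence $(U_i)_{i\in\omega}$ of subsets of $3^\omega$ with $\lambda(U_i)\le 2^{-i}$ for all $i$. Let $\sigma_0=\epsilon,\ \sigma_1=0,\ \sigma_2=1,\ \sigma_3=00,\dots$ be the length-lexicographic enumeration of $2^{<\omega}$. Each $x\in 3^\omega$ codes a partial function $F_x:\subseteq 2^\omega\to 2^\omega$, continuous on its domain, as follows: label the nonempty strings by $\ell_x(\sigma_i)=x(i-1)$ for $i\ge 1$, and let $F_x(y)$ be the sequence obtained from $\ell_x(y\restriction 1),\ell_x(y\restriction 2),\ell_x(y\restriction 3),\dots$ by removing all $2$'s ($F_x(y)$ is undefined if only finitely many terms remain). A partial function $F$ on $2^\omega$ is a random continuous function if $F=F_x$ for some Martin-Löf random $x\in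 3^\omega$. **Corollary.** Let $F$ be a random continuous function, and let $\lambda_F=\lambda\circ F^{-1}$ be the Borel measure on $2^\omega$ that it induces, i.e. $\lambda_F(A)=\lambda(\{y\in\operatorname{dom}F: F(y)\in A\})$. Then $\lambda_F$ is atomless, that is, $\lambda_F(\{z\})=0$ for every $z\in 2^\omega$. -/

import Mathlib

namespace RandomContinuous

open MeasureTheory Set
open scoped ENNReal

/-! ### Sequence spaces, cylinders, Lebesgue measure -/

/-- The space `n^ω` of infinite sequences over the alphabet `{0, …, n-1}`. -/
abbrev SeqSpace (n : ℕ) : Type := ℕ → Fin n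

/-- The initial segment `x ↾ k`, of length `k`. -/
def initSeg {n : ℕ} (x : SeqSpace n) (k : ℕ) : List (Fin n) :=
  List.ofFn fun i : Fin k => x i

/-- The basic clopen set `⟦σ⟧` of all sequences extending the string `σ`. -/
def cylinder {n : ℕ} (σ : List (Fin n)) : Set (SeqSpace n) :=
  {x | initSeg x σ.length = σ}

/-- The Lebesgue measure on `n^ω`: the product of the uniform probability measures on the
alphabet. -/
noncomputable def lebesgue (n : ℕ) [NeZero n] : Measure (SeqSpace n) :=
  Measure.infinitePi fun _ : ℕ => (PMF.uniformOfFintype (Fin n)).toMeasure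

/-- `λ(⟦σ⟧) = n^{-|σ|}`. -/
theorem lebesgue_cylinder (n : ℕ) [NeZero n] (σ : List (Fin n)) :
    lebesgue n (cylinder σ) = ((n : ℝ≥0∞)⁻¹) ^ σ.length := by
  classical
  have h : cylinder σ = Set.pi (Finset.range σ.length : Set ℕ)
      (fun i => {a : Fin n | σ[i]? = some a}) := by
    ext x
    simp only [cylinder, initSeg, Set.mem_ofPred_eq, Set.mem_pi, Finset.coe_range, Set.mem_Iio]
    constructor
    · intro hx i hi
      rw [← hx]
      simp [hi]
    · intro hx
      refine List.ext_getElem (by simp) ?_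
      intro i h1 h2
      have := hx i h2
      rw [List.getElem?_eq_getElem h2] at this
      simpa using (Option.some.inj this).symm
  rw [h, lebesgue, Measure.infinitePi_pi _ (fun i _ => MeasurableSet.of_discrete)]
  have hone : ∀ i ∈ Finset.range σ.length,
      (PMF.uniformOfFintype (Fin n)).toMeasure {a : Fin n | σ[i]? = some a}
        = (n : ℝ≥0∞)⁻¹ := by
    intro i hi
    have hi' : i < σ.length := Finset.mem_range.1 hi
    have hs : {a : Fin n | σ[i]? = some a} = {σ[i]} := by
      ext a
      rw [List.getElem?_eq_getElem hi']
      simp [eq_comm]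
    rw [hs, PMF.toMeasure_apply_singleton _ _ (measurableSet_singleton _)]
    simp
  rw [Finset.prod_congr rfl hone]
  simp

/-! ### Martin-Löf randomness -/

/-- `(U i)` is a uniformly `Σ⁰₁` sequence of subsets of `n^ω`: there is a computably enumerable
set of pairs `(i, σ)` such that each `U i` is the union of the `⟦σ⟧` with `(i, σ)` in it. -/
def UniformlySigma01 {n : ℕ} (U : ℕ → Set (SeqSpace n)) : Prop :=
  ∃ W : ℕ × List (Fin n) → Prop, REPred W ∧
    ∀ i, U i = {x | ∃ σ, W (i, σ) ∧ x ∈ cylinder σ}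

/-- A `μ`-Martin-Löf test. -/
def IsMLTest {n : ℕ} (μ : Measure (SeqSpace n)) (U : ℕ → Set (SeqSpace n)) : Prop :=
  UniformlySigma01 U ∧ ∀ i, μ (U i) ≤ (2⁻¹ : ℝ≥0∞) ^ i

/-- `x` is `μ`-Martin-Löf random: it passes every `μ`-Martin-Löf test. -/
def IsMLRandom {n : ℕ} (μ : Measure (SeqSpace n)) (x : SeqSpace n) : Prop :=
  ∀ U : ℕ → Set (SeqSpace n), IsMLTest μ U → x ∉ ⋂ i, U i

/-! ### The canonical enumeration of binary strings -/

/-- The index of `σ` in the length-lexicographic enumeration `ε, 0, 1, 00, 01, 10, 11, 000, …`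
of the binary strings; thus `ε` has index `0`, and if `σ` has index `m`, then `σ0` and `σ1` have
the indices `2m+1` and `2m+2`. -/
def strIndex (σ : List (Fin 2)) : ℕ :=
  σ.foldl (fun m b => 2 * m + 1 + (b : ℕ)) 0

theorem strIndex_nil : strIndex [] = 0 := rfl

theorem strIndex_concat (σ : List (Fin 2)) (b : Fin 2) :
    strIndex (σ ++ [b]) = 2 * strIndex σ + 1 + (b : ℕ) := by
  simp [strIndex]

theorem strIndex_bijective : Function.Bijective strIndex := by
  constructor
  · intro σ
    induction σ using List.reverseRecOn with
    | nil =>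
      intro τ h
      induction τ using List.reverseRecOn with
      | nil => rfl
      | append_singleton τ c _ =>
        rw [strIndex_concat, strIndex_nil] at h
        omega
    | append_singleton σ b ih =>
      intro τ h
      induction τ using List.reverseRecOn with
      | nil =>
        rw [strIndex_concat, strIndex_nil] at h
        omega
      | append_singleton τ c _ =>
        rw [strIndex_concat, strIndex_concat] at h
        have hb := b.isLt
        have hc := c.isLt
        have h1 : strIndex σ = strIndex τ := by omega
        have h2 : b = c := Fin.ext (by omega)
        rw [ih h1, h2]
  · intro m
    induction m using Nat.strong_induction_on with
    | _ m ih =>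
      rcases Nat.eq_zero_or_pos m with rfl | hm
      · exact ⟨[], rfl⟩
      · obtain ⟨σ, hσ⟩ := ih ((m - 1) / 2) (by omega)
        refine ⟨σ ++ [⟨(m - 1) % 2, Nat.mod_lt _ (by norm_num)⟩], ?_⟩
        rw [strIndex_concat, hσ]
        show 2 * ((m - 1) / 2) + 1 + (m - 1) % 2 = m
        omega

/-! ### Partial continuous functions coded by elements of `3^ω` -/

/-- The labelling `ℓ_x` of the non-empty binary strings: the `i`-th string, `i ≥ 1`, has the
label `x (i - 1)`. (The value at the empty string is never used.) -/
def label (x : SeqSpace 3) (σ : List (Fin 2)) : Fin 3 :=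
  x (strIndex σ - 1)

/-- The sequence `ℓ_x(y ↾ 1), ℓ_x(y ↾ 2), …` of the labels along `y`. -/
def labelsAlong (x : SeqSpace 3) (y : SeqSpace 2) (k : ℕ) : Fin 3 :=
  label x (initSeg y (k + 1))

/-- The partial function `F_x : ⊆ 2^ω → 2^ω` coded by `x`: `F_x(y)` is what is left of the
labels along `y` after the `2`s are removed, and is undefined if only finitely many labels are
left. (`Nat.nth p j` is the position of the `j`-th label, counted from `0`, with property `p`.) -/
noncomputable def codedFunction (x : SeqSpace 3) : SeqSpace 2 →. SeqSpace 2 := fun y =>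
  { Dom := {k | labelsAlong x y k ≠ 2}.Infinite
    get := fun h j =>
      (labelsAlong x y (Nat.nth (fun k => labelsAlong x y k ≠ 2) j)).castPred
        (Nat.nth_mem_of_infinite h j) }

/-- A partial function `F` on `2^ω` is a random continuous function if it is coded by a
Martin-Löf random element of `3^ω`. (It is continuous on its domain then, see
`continuous_codedFunction`.) -/
def IsRandomContinuousFunction (F : SeqSpace 2 →. SeqSpace 2) : Prop :=
  ∃ x : SeqSpace 3, IsMLRandom (lebesgue 3) x ∧ F = codedFunction x

/-! ### The measure induced by a partial function -/

/-- The measure `λ_F = λ ∘ F⁻¹` on `2^ω` induced by a partial function `F`: the restriction of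
`λ` to the domain of `F`, pushed forward by `F`. -/
noncomputable def inducedMeasure (F : SeqSpace 2 →. SeqSpace 2) : Measure (SeqSpace 2) :=
  Measure.map F.asSubtype (Measure.comap (Subtype.val : F.Dom → SeqSpace 2) (lebesgue 2))

/-! ### Each `F_x` is continuous on a Borel domain, and `λ_{F_x} = λ ∘ F_x⁻¹` holds literally -/

theorem labelsAlong_congr (x : SeqSpace 3) {y y' : SeqSpace 2} {k : ℕ}
    (h : ∀ i ≤ k, y i = y' i) : labelsAlong x y k = labelsAlong x y' k := by
  have : initSeg y (k + 1) = initSeg y' (k + 1) := by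
    unfold initSeg
    congr 1
    funext i
    exact h i (Nat.lt_succ_iff.1 i.isLt)
  rw [labelsAlong, labelsAlong, this]

theorem measurable_labelsAlong (x : SeqSpace 3) (k : ℕ) :
    Measurable fun y => labelsAlong x y k := by
  have h : (fun y => labelsAlong x y k) =
      (fun v : Fin (k + 1) → Fin 2 => label x (List.ofFn v)) ∘ fun y i => y i := rfl
  rw [h]
  exact (measurable_of_finite _).comp (measurable_pi_lambda _ fun i => measurable_pi_apply _)

theorem measurableSet_dom_codedFunction (x : SeqSpace 3) :
    MeasurableSet (codedFunction x).Dom := by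
  have h : (codedFunction x).Dom = ⋂ N : ℕ, ⋃ k : ℕ, ⋃ _ : N < k,
      {y | labelsAlong x y k ≠ 2} := by
    ext y
    simp only [Set.mem_iInter, Set.mem_iUnion, Set.mem_ofPred_eq]
    change {k | labelsAlong x y k ≠ 2}.Infinite ↔ _
    constructor
    · intro hy N
      obtain ⟨k, hk, hN⟩ := hy.exists_gt N
      exact ⟨k, hN, hk⟩
    · intro hy
      refine Set.infinite_of_forall_exists_gt fun N => ?_
      obtain ⟨k, hN, hk⟩ := hy N
      exact ⟨k, hk, hN⟩
  rw [h]
  refine MeasurableSet.iInter fun N => MeasurableSet.iUnion fun k => MeasurableSet.iUnion fun _ => ?_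
  exact (measurable_labelsAlong x k) (MeasurableSet.of_discrete (s := {a : Fin 3 | a ≠ 2}))

theorem continuous_codedFunction (x : SeqSpace 3) : Continuous (codedFunction x).asSubtype := by
  refine continuous_pi fun j => continuous_iff_continuousAt.2 fun y => ?_
  have hinf : {k | labelsAlong x y.1 k ≠ 2}.Infinite := y.2
  set K := Nat.nth (fun k => labelsAlong x y.1 k ≠ 2) j with hK
  have hopen : ∀ᶠ y' : (codedFunction x).Dom in nhds y, ∀ i ∈ Finset.range (K + 1),
      y'.1 i = y.1 i := by
    rw [Filter.eventually_all_finset]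
    intro i _
    have hc : Continuous fun y' : (codedFunction x).Dom => y'.1 i :=
      (continuous_apply i).comp continuous_subtype_val
    exact hc.continuousAt.eventually (IsOpen.mem_nhds (isOpen_discrete {y.1 i}) rfl)
  refine Filter.Tendsto.congr' (f₁ := fun _ => (codedFunction x).asSubtype y j) ?_
    tendsto_const_nhds
  filter_upwards [hopen] with y' hy'
  have hlab : ∀ k ≤ K, labelsAlong x y'.1 k = labelsAlong x y.1 k := fun k hk =>
    labelsAlong_congr x fun i hi => hy' i (Finset.mem_range.2 (by omega))
  have hKmem : labelsAlong x y.1 K ≠ 2 := Nat.nth_mem_of_infinite hinf j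
  have hcount : Nat.count (fun k => labelsAlong x y'.1 k ≠ 2) K = j := by
    have h1 : Nat.count (fun k => labelsAlong x y'.1 k ≠ 2) K =
        Nat.count (fun k => labelsAlong x y.1 k ≠ 2) K := by
      rw [Nat.count_eq_card_filter_range, Nat.count_eq_card_filter_range]
      congr 1
      refine Finset.filter_congr fun k hk => ?_
      rw [hlab k (Finset.mem_range.1 hk).le]
    rw [h1, hK, Nat.count_nth_of_infinite hinf]
  have hnth : Nat.nth (fun k => labelsAlong x y'.1 k ≠ 2) j = K := by
    have := Nat.nth_count (p := fun k => labelsAlong x y'.1 k ≠ 2) (n := K)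
      (by rw [hlab K le_rfl]; exact hKmem)
    rwa [hcount] at this
  apply Fin.ext
  change (labelsAlong x y.1 K : ℕ) =
    (labelsAlong x y'.1 (Nat.nth (fun k => labelsAlong x y'.1 k ≠ 2) j) : ℕ)
  rw [hnth, hlab K le_rfl]

/-- `λ_{F_x}(A) = λ(F_x⁻¹(A))` for all Borel sets `A`. -/
theorem inducedMeasure_codedFunction_apply (x : SeqSpace 3) {A : Set (SeqSpace 2)}
    (hA : MeasurableSet A) :
    inducedMeasure (codedFunction x) A = lebesgue 2 ((codedFunction x).preimage A) := by
  have hD := measurableSet_dom_codedFunction x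
  have hm : Measurable (codedFunction x).asSubtype := (continuous_codedFunction x).measurable
  rw [inducedMeasure, Measure.map_apply hm hA,
    comap_subtype_coe_apply hD]
  congr 1
  ext y
  simp only [Set.mem_image, Set.mem_preimage, PFun.mem_preimage]
  constructor
  · rintro ⟨⟨y', hy'⟩, hyA, rfl⟩
    exact ⟨_, hyA, Part.get_mem hy'⟩
  · rintro ⟨z, hz, hy, rfl⟩
    exact ⟨⟨y, hy⟩, hz, rfl⟩

end RandomContinuous

namespace RandomContinuous

open MeasureTheory Set
open scoped ENNReal

/-! ### Counting the paths along which a given string is output -/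

/-! Let `x` be a uniformly random labelling and `σ` a string of length `n`. Along a path, each label
is `2` (nothing is output), the next bit of `σ`, or the wrong bit, each with probability `1/3`.
Among the `2 ^ N` paths of length `N`, let `Z` be the fraction along which `σ` has been output. The
subtrees below the two children of a node carry independent labels, so the moments of `Z` satisfy
recursions, which give `E Z ≤ 2 ^ (-n)` and `E Z² ≤ 3 * 4 ^ (-n)` uniformly in `N`
(`lintegral_leafVar_le`, `lintegral_leafVar_sq_le`).

By Markov's inequality for `Z²`, `Z ≥ 2 ^ (-i)` has probability at most `3 * 4 ^ (i - n)`. A union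
bound over the `2 ^ n` strings leaves `3 * 4 ^ i * 2 ^ (-n)`; the first moment would leave the
useless bound `2 ^ i`. For `n = 3 * i + 2` this is below `2 ^ (-i)`. As `Z` grows with `N`, the
bound survives the union over all `N` (`lebesgue_heavySet_le`). The resulting sets are uniformly
`Σ⁰₁` (`heavySet_eq`, `rePred_hasHeavyString`), so their shifts are Martin-Löf tests.

If `F_x` had an atom `z` of mass above `2 ^ (-k)`, then for every `i ≥ k` the initial segment of `z`
of length `3 * i + 2` would be output along more than the fraction `2 ^ (-i)` of the paths of some
finite length (`mem_heavySet_of_lt`). So `x` would fail a test. -/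

/-- Reading the label `c` while the string `τ` remains to be output: the label `2` is skipped, once
nothing remains every label is accepted, and otherwise the label has to be the head of `τ`. The
value `none` stands for a failure; an unknown label is a failure as well. -/
def advance (c : Option (Fin 3)) (τ : List (Fin 2)) : Option (List (Fin 2)) :=
  if c = none then none
  else if c = some 2 ∨ τ = [] then some τ
  else if τ.head?.map Fin.castSucc = c then some τ.tail
  else none

theorem advance_none (τ : List (Fin 2)) : advance none τ = none := by simp [advance]

theorem advance_nil (c : Fin 3) : advance (some c) [] = some [] := by simp [advance]

theorem advance_two (τ : List (Fin 2)) : advance (some 2) τ = some τ := by simp [advance]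

theorem advance_cons (c : Fin 3) (t : Fin 2) (τ : List (Fin 2)) :
    advance (some c) (t :: τ) =
      if c = 2 then some (t :: τ) else if c = t.castSucc then some τ else none := by
  simp [advance, eq_comm]

/-- The number of descendants, `N` levels below the node `m`, of the complete binary tree such that
`τ` is output on the way from `m` to them. The children of the node `m` are `2m+1` and `2m+2`, and
`g j` is the label of the node `j+1`. -/
def leafCount (g : ℕ → Option (Fin 3)) : ℕ → List (Fin 2) → ℕ → ℕ
  | 0, τ, _ => if τ = [] then 1 else 0
  | N + 1, τ, m =>
      (advance (g (2 * m)) τ).elim 0 (fun τ' => leafCount g N τ' (2 * m + 1)) +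
      (advance (g (2 * m + 1)) τ).elim 0 (fun τ' => leafCount g N τ' (2 * m + 2))

theorem leafCount_nil (x : SeqSpace 3) (N m : ℕ) :
    leafCount (fun i => some (x i)) N [] m = 2 ^ N := by
  induction N generalizing m with
  | zero => simp [leafCount]
  | succ N ih => simp [leafCount, advance_nil, ih]; ring

theorem leafCount_mono {g g' : ℕ → Option (Fin 3)} (h : ∀ i c, g i = some c → g' i = some c)
    (N : ℕ) (τ : List (Fin 2)) (m : ℕ) : leafCount g N τ m ≤ leafCount g' N τ m := by
  induction N generalizing τ m with
  | zero => simp [leafCount]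
  | succ N ih =>
    have key : ∀ j k, (advance (g j) τ).elim 0 (fun τ' => leafCount g N τ' k) ≤
        (advance (g' j) τ).elim 0 (fun τ' => leafCount g' N τ' k) := by
      intro j k
      rcases hg : g j with _ | c
      · simp [advance_none]
      · rw [h j c hg]
        rcases advance (some c) τ with _ | τ'
        · simp
        · exact ih τ' k
    exact Nat.add_le_add (key _ _) (key _ _)

/-- Passing to the right child doubles `m + 2`, so the last node `N` levels below `m` is `2 ^ N * (m
+ 2) - 2`; the index of its label is one less. -/
theorem leafCount_congr {g g' : ℕ → Option (Fin 3)} (N : ℕ) (τ : List (Fin 2)) (m : ℕ)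
    (h : ∀ i, i + 2 < 2 ^ N * (m + 2) → g i = g' i) : leafCount g N τ m = leafCount g' N τ m := by
  induction N generalizing τ m with
  | zero => simp [leafCount]
  | succ N ih =>
    have hN : 1 ≤ 2 ^ N := Nat.one_le_two_pow
    have h0 : g (2 * m) = g' (2 * m) := h _ (by rw [pow_succ]; nlinarith)
    have h1 : g (2 * m + 1) = g' (2 * m + 1) := h _ (by rw [pow_succ]; nlinarith)
    have e : ∀ τ', leafCount g N τ' (2 * m + 1) = leafCount g' N τ' (2 * m + 1) := fun τ' =>
      ih τ' _ fun i hi => h i (by rw [pow_succ]; nlinarith)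
    have e' : ∀ τ', leafCount g N τ' (2 * m + 2) = leafCount g' N τ' (2 * m + 2) := fun τ' =>
      ih τ' _ fun i hi => h i (by rw [pow_succ]; nlinarith)
    simp only [leafCount, h0, h1, e, e']

/-- Once `τ` has been output, both one-step extensions of the path count. Hence the fraction of
successful paths never decreases with `N`. -/
theorem two_mul_leafCount_le (x : SeqSpace 3) (N : ℕ) (τ : List (Fin 2)) (m : ℕ) :
    2 * leafCount (fun i => some (x i)) N τ m ≤ leafCount (fun i => some (x i)) (N + 1) τ m := by
  induction N generalizing τ m with
  | zero =>
    rcases τ with _ | ⟨t, τ⟩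
    · simp [leafCount_nil]
    · simp [leafCount]
  | succ N ih =>
    have key : ∀ j k, 2 * (advance (some (x j)) τ).elim 0
          (fun τ' => leafCount (fun i => some (x i)) N τ' k) ≤
        (advance (some (x j)) τ).elim 0
          (fun τ' => leafCount (fun i => some (x i)) (N + 1) τ' k) := by
      intro j k
      rcases advance (some (x j)) τ with _ | τ'
      · simp
      · exact ih τ' k
    rw [leafCount, leafCount, mul_add]
    exact Nat.add_le_add (key _ _) (key _ _)

/-! ### The coordinates on which these numbers depend -/

/-- The indices of the labels below the node `m`. -/
def labelsBelow (m : ℕ) : Set ℕ := {i | ∃ d, (i + 2) / 2 ^ (d + 1) = m + 1}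

/-- The label `i` belongs to the node `i + 1`. Numbering nodes from `1`, this is `i + 2`, and
halving leads to the parent, so proper ancestors have smaller numbers. -/
theorem notMem_labelsBelow (j : ℕ) : j ∉ labelsBelow (j + 1) := by
  rintro ⟨d, hd⟩
  have : (j + 2) / 2 ^ (d + 1) < j + 2 := Nat.div_lt_self (by omega) (Nat.one_lt_two_pow (by omega))
  omega

theorem insert_labelsBelow_subset {m j : ℕ} (h : (j + 2) / 2 = m + 1) :
    insert j (labelsBelow (j + 1)) ⊆ labelsBelow m := by
  rintro i (rfl | ⟨d, hd⟩)
  · exact ⟨0, by simpa using h⟩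
  · refine ⟨d + 1, ?_⟩
    rw [pow_succ, ← Nat.div_div_eq_div_mul, hd]
    exact h

theorem mem_insert_labelsBelow {i j : ℕ} (h : i ∈ insert j (labelsBelow (j + 1))) :
    ∃ d, (i + 2) / 2 ^ d = j + 2 := by
  rcases h with rfl | ⟨d, hd⟩
  · exact ⟨0, by simp⟩
  · exact ⟨d + 1, hd⟩

theorem disjoint_labelsBelow (m : ℕ) :
    Disjoint (insert (2 * m) (labelsBelow (2 * m + 1)))
      (insert (2 * m + 1) (labelsBelow (2 * m + 2))) := by
  rw [Set.disjoint_left]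
  intro i h h'
  obtain ⟨d, hd⟩ := mem_insert_labelsBelow h
  obtain ⟨e, he⟩ := mem_insert_labelsBelow h'
  rcases lt_trichotomy d e with hlt | rfl | hlt
  · obtain ⟨k, rfl⟩ := Nat.exists_eq_add_of_lt hlt
    rw [add_assoc, pow_add, ← Nat.div_div_eq_div_mul, hd] at he
    have : (2 * m + 2) / 2 ^ (k + 1) ≤ 2 * m + 2 := Nat.div_le_self _ _
    omega
  · omega
  · obtain ⟨k, rfl⟩ := Nat.exists_eq_add_of_lt hlt
    -- The bound `2 * m + 3` on the quotient would not exclude `2 * m + 2`; one halving is split off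
    -- to bring it down to `m + 1`.
    rw [add_assoc, pow_add, ← Nat.div_div_eq_div_mul, he, pow_succ', ← Nat.div_div_eq_div_mul] at hd
    have : (2 * m + 1 + 2) / 2 / 2 ^ k ≤ (2 * m + 1 + 2) / 2 := Nat.div_le_self _ _
    omega

/-! ### Independence of functions of disjoint sets of coordinates -/

/-- The σ-algebra generated by the coordinates in `S`. -/
abbrev coordAlgebra (S : Set ℕ) : MeasurableSpace (SeqSpace 3) :=
  ⨆ i ∈ S, MeasurableSpace.comap (fun x : SeqSpace 3 => x i) inferInstance

theorem coordAlgebra_le (S : Set ℕ) : coordAlgebra S ≤ MeasurableSpace.pi :=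
  iSup₂_le fun i _ => (measurable_pi_apply i).comap_le

theorem coordAlgebra_mono {S T : Set ℕ} (h : S ⊆ T) : coordAlgebra S ≤ coordAlgebra T :=
  biSup_mono h

theorem measurable_coord {S : Set ℕ} {j : ℕ} (hj : j ∈ S) :
    Measurable[coordAlgebra S] fun x : SeqSpace 3 => x j :=
  (comap_measurable _).mono (le_biSup (fun i => MeasurableSpace.comap
    (fun x : SeqSpace 3 => x i) inferInstance) hj) le_rfl

instance isProbabilityMeasure_lebesgue (n : ℕ) [NeZero n] : IsProbabilityMeasure (lebesgue n) := by
  unfold lebesgue; infer_instance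

theorem indep_coordAlgebra {S T : Set ℕ} (h : Disjoint S T) :
    ProbabilityTheory.Indep (coordAlgebra S) (coordAlgebra T) (lebesgue 3) :=
  ProbabilityTheory.indep_iSup_of_disjoint (fun i => (measurable_pi_apply i).comap_le)
    (ProbabilityTheory.iIndepFun_infinitePi (X := fun (_ : ℕ) (a : Fin 3) => a)
      fun _ => measurable_id) h

theorem lintegral_mul_of_disjoint {S T : Set ℕ} (h : Disjoint S T) {f g : SeqSpace 3 → ℝ≥0∞}
    (hf : Measurable[coordAlgebra S] f) (hg : Measurable[coordAlgebra T] g) :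
    ∫⁻ x, f x * g x ∂lebesgue 3 = (∫⁻ x, f x ∂lebesgue 3) * ∫⁻ x, g x ∂lebesgue 3 :=
  ProbabilityTheory.lintegral_mul_eq_lintegral_mul_lintegral_of_independent_measurableSpace
    (coordAlgebra_le S) (coordAlgebra_le T) (indep_coordAlgebra h) hf hg

theorem lintegral_coord_eq (j : ℕ) (c : Fin 3) :
    ∫⁻ x, (if x j = c then 1 else 0 : ℝ≥0∞) ∂lebesgue 3 = 3⁻¹ := by
  have h := (measurePreserving_eval_infinitePi
    (fun _ : ℕ => (PMF.uniformOfFintype (Fin 3)).toMeasure) j).lintegral_comp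
    (f := fun a => if a = c then 1 else 0) (measurable_of_finite _)
  refine h.trans ?_
  rw [lintegral_fintype]
  simp

theorem lintegral_ite_coord {S : Set ℕ} {j : ℕ} (hj : j ∉ S) (c : Fin 3) {f : SeqSpace 3 → ℝ≥0∞}
    (hf : Measurable[coordAlgebra S] f) :
    ∫⁻ x, (if x j = c then f x else 0) ∂lebesgue 3 = 3⁻¹ * ∫⁻ x, f x ∂lebesgue 3 := by
  rw [← lintegral_coord_eq j c, ← lintegral_mul_of_disjoint (Set.disjoint_singleton_left.2 hj) _ hf]
  · simp
  · exact (measurable_of_finite fun a : Fin 3 => if a = c then (1 : ℝ≥0∞) else 0).comp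
      (measurable_coord rfl)

/-! ### Moments -/

/-- `leafCount` for a total labelling, as an extended real random variable. -/
noncomputable def leafVar (N : ℕ) (τ : List (Fin 2)) (m : ℕ) (x : SeqSpace 3) : ℝ≥0∞ :=
  leafCount (fun i => some (x i)) N τ m

/-- The contribution of the child `j+1` of a node to `leafVar`. -/
noncomputable def branchVar (N : ℕ) (t : Fin 2) (τ : List (Fin 2)) (j : ℕ) (x : SeqSpace 3) :
    ℝ≥0∞ :=
  (if x j = 2 then leafVar N (t :: τ) (j + 1) x else 0) +
    if x j = t.castSucc then leafVar N τ (j + 1) x else 0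

theorem castSucc_ne_two (t : Fin 2) : t.castSucc ≠ (2 : Fin 3) := by
  revert t; decide

theorem leafVar_nil (N m : ℕ) (x : SeqSpace 3) : leafVar N [] m x = 2 ^ N := by
  simp [leafVar, leafCount_nil]

theorem leafVar_zero_cons (t : Fin 2) (τ : List (Fin 2)) (m : ℕ) (x : SeqSpace 3) :
    leafVar 0 (t :: τ) m x = 0 := by
  simp [leafVar, leafCount]

theorem leafVar_succ_cons (N : ℕ) (t : Fin 2) (τ : List (Fin 2)) (m : ℕ) (x : SeqSpace 3) :
    leafVar (N + 1) (t :: τ) m x =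
      branchVar N t τ (2 * m) x + branchVar N t τ (2 * m + 1) x := by
  have key : ∀ j, ((advance (some (x j)) (t :: τ)).elim 0
      (fun τ' => leafCount (fun i => some (x i)) N τ' (j + 1)) : ℕ) = branchVar N t τ j x := by
    intro j
    rw [advance_cons, branchVar]
    by_cases h : x j = 2
    · simp [h, leafVar, (castSucc_ne_two t).symm]
    · by_cases h' : x j = t.castSucc
      · simp [h', leafVar, castSucc_ne_two]
      · simp [h, h']
  rw [leafVar, leafCount, Nat.cast_add, key, key]

/-- The two summands of `branchVar` live on disjoint events, so there is no cross term. -/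
theorem branchVar_sq (N : ℕ) (t : Fin 2) (τ : List (Fin 2)) (j : ℕ) (x : SeqSpace 3) :
    branchVar N t τ j x ^ 2 = (if x j = 2 then leafVar N (t :: τ) (j + 1) x ^ 2 else 0) +
      if x j = t.castSucc then leafVar N τ (j + 1) x ^ 2 else 0 := by
  rw [branchVar]
  by_cases h : x j = 2
  · simp [h, (castSucc_ne_two t).symm]
  · simp [h]

theorem measurable_ite_coord {S : Set ℕ} {j : ℕ} (hj : j ∈ S) (c : Fin 3) {f : SeqSpace 3 → ℝ≥0∞}
    (hf : Measurable[coordAlgebra S] f) :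
    Measurable[coordAlgebra S] fun x => if x j = c then f x else 0 :=
  Measurable.ite ((measurable_coord hj) (measurableSet_singleton c)) hf measurable_const

/-- The hypothesis is the level-`N` case of `measurable_leafVar`, whose induction uses this lemma.
-/
theorem measurable_branchVar_of {N : ℕ}
    (h : ∀ τ m, Measurable[coordAlgebra (labelsBelow m)] (leafVar N τ m))
    (t : Fin 2) (τ : List (Fin 2)) (j : ℕ) :
    Measurable[coordAlgebra (insert j (labelsBelow (j + 1)))] (branchVar N t τ j) := by
  have h' : ∀ τ, Measurable[coordAlgebra (insert j (labelsBelow (j + 1)))] (leafVar N τ (j + 1)) :=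
    fun τ => (h τ _).mono (coordAlgebra_mono (Set.subset_insert _ _)) le_rfl
  exact Measurable.add (measurable_ite_coord (Set.mem_insert _ _) _ (h' _))
    (measurable_ite_coord (Set.mem_insert _ _) _ (h' _))

theorem measurable_leafVar (N : ℕ) (τ : List (Fin 2)) (m : ℕ) :
    Measurable[coordAlgebra (labelsBelow m)] (leafVar N τ m) := by
  induction N generalizing τ m with
  | zero =>
    have : leafVar 0 τ m = fun _ => ((if τ = [] then 1 else 0 : ℕ) : ℝ≥0∞) := rfl
    rw [this]
    exact measurable_const
  | succ N ih =>
    rcases τ with _ | ⟨t, τ⟩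
    · have : leafVar (N + 1) [] m = fun _ => 2 ^ (N + 1) := funext fun x => leafVar_nil _ _ x
      rw [this]
      exact measurable_const
    · have : leafVar (N + 1) (t :: τ) m =
          fun x => branchVar N t τ (2 * m) x + branchVar N t τ (2 * m + 1) x :=
        funext fun x => leafVar_succ_cons _ _ _ _ x
      rw [this]
      exact Measurable.add
        ((measurable_branchVar_of ih t τ _).mono
          (coordAlgebra_mono (insert_labelsBelow_subset (by omega))) le_rfl)
        ((measurable_branchVar_of ih t τ _).mono
          (coordAlgebra_mono (insert_labelsBelow_subset (by omega))) le_rfl)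

theorem measurable_branchVar (N : ℕ) (t : Fin 2) (τ : List (Fin 2)) (j : ℕ) :
    Measurable[coordAlgebra (insert j (labelsBelow (j + 1)))] (branchVar N t τ j) :=
  measurable_branchVar_of (measurable_leafVar N) t τ j

theorem lintegral_add_ite_coord (j : ℕ) (c c' : Fin 3) {f f' : SeqSpace 3 → ℝ≥0∞}
    (hf : Measurable[coordAlgebra (labelsBelow (j + 1))] f)
    (hf' : Measurable[coordAlgebra (labelsBelow (j + 1))] f') :
    ∫⁻ x, ((if x j = c then f x else 0) + if x j = c' then f' x else 0) ∂lebesgue 3 =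
      3⁻¹ * (∫⁻ x, f x ∂lebesgue 3 + ∫⁻ x, f' x ∂lebesgue 3) := by
  have hm : ∀ (c : Fin 3) (f : SeqSpace 3 → ℝ≥0∞),
      Measurable[coordAlgebra (labelsBelow (j + 1))] f →
      Measurable fun x => if x j = c then f x else 0 := fun c f hf =>
    (measurable_ite_coord (Set.mem_insert _ _) c
      (hf.mono (coordAlgebra_mono (Set.subset_insert j _)) le_rfl)).mono (coordAlgebra_le _) le_rfl
  rw [lintegral_add_left (hm c f hf), lintegral_ite_coord (notMem_labelsBelow j) c hf,
    lintegral_ite_coord (notMem_labelsBelow j) c' hf', mul_add]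

theorem lintegral_branchVar (N : ℕ) (t : Fin 2) (τ : List (Fin 2)) (j : ℕ) :
    3 * ∫⁻ x, branchVar N t τ j x ∂lebesgue 3 =
      ∫⁻ x, leafVar N (t :: τ) (j + 1) x ∂lebesgue 3 + ∫⁻ x, leafVar N τ (j + 1) x ∂lebesgue 3 := by
  have := lintegral_add_ite_coord j 2 t.castSucc (measurable_leafVar N (t :: τ) (j + 1))
    (measurable_leafVar N τ (j + 1))
  simp only [branchVar]
  rw [this, ← mul_assoc, ENNReal.mul_inv_cancel (by simp) (by simp), one_mul]

theorem lintegral_branchVar_sq (N : ℕ) (t : Fin 2) (τ : List (Fin 2)) (j : ℕ) :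
    3 * ∫⁻ x, branchVar N t τ j x ^ 2 ∂lebesgue 3 =
      ∫⁻ x, leafVar N (t :: τ) (j + 1) x ^ 2 ∂lebesgue 3 +
        ∫⁻ x, leafVar N τ (j + 1) x ^ 2 ∂lebesgue 3 := by
  have := lintegral_add_ite_coord j 2 t.castSucc
    (f := fun x => leafVar N (t :: τ) (j + 1) x ^ 2) (f' := fun x => leafVar N τ (j + 1) x ^ 2)
    (Measurable.pow_const (measurable_leafVar N (t :: τ) (j + 1)) 2)
    (Measurable.pow_const (measurable_leafVar N τ (j + 1)) 2)
  simp only [branchVar_sq]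
  rw [this, ← mul_assoc, ENNReal.mul_inv_cancel (by simp) (by simp), one_mul]

/-- The weight `2 ^ τ.length` is the one preserved by the recursion: skipping contributes `1`,
matching a bit contributes `2`, and `(1 + 2) / 3 = 1`. -/
theorem lintegral_branchVar_le {N : ℕ}
    (h : ∀ τ m, 2 ^ τ.length * ∫⁻ x, leafVar N τ m x ∂lebesgue 3 ≤ 2 ^ N)
    (t : Fin 2) (τ : List (Fin 2)) (j : ℕ) :
    2 ^ (t :: τ).length * ∫⁻ x, branchVar N t τ j x ∂lebesgue 3 ≤ 2 ^ N := by
  have h1 := h (t :: τ) (j + 1)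
  have h2 := h τ (j + 1)
  have e := lintegral_branchVar N t τ j
  refine (ENNReal.mul_le_mul_iff_right (a := 3) (by simp) (by simp)).1 ?_
  calc (3 : ℝ≥0∞) * (2 ^ (t :: τ).length * ∫⁻ x, branchVar N t τ j x ∂lebesgue 3)
      = 2 ^ (t :: τ).length * ∫⁻ x, leafVar N (t :: τ) (j + 1) x ∂lebesgue 3 +
        2 * (2 ^ τ.length * ∫⁻ x, leafVar N τ (j + 1) x ∂lebesgue 3) := by
        rw [mul_left_comm, e, mul_add, List.length_cons, pow_succ']
        ring
    _ ≤ 2 ^ N + 2 * 2 ^ N := by gcongr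
    _ = 3 * 2 ^ N := by ring

theorem lintegral_leafVar_le (N : ℕ) (τ : List (Fin 2)) (m : ℕ) :
    2 ^ τ.length * ∫⁻ x, leafVar N τ m x ∂lebesgue 3 ≤ 2 ^ N := by
  rcases τ with _ | ⟨t, τ⟩
  · simp [leafVar_nil]
  · induction N generalizing t τ m with
    | zero => simp [leafVar_zero_cons]
    | succ N ih =>
      have ih' : ∀ τ m, 2 ^ τ.length * ∫⁻ x, leafVar N τ m x ∂lebesgue 3 ≤ 2 ^ N := by
        rintro (_ | ⟨t, τ⟩) m
        · simp [leafVar_nil]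
        · exact ih m t τ
      simp only [leafVar_succ_cons]
      rw [lintegral_add_left ((measurable_branchVar N t τ _).mono (coordAlgebra_le _) le_rfl),
        mul_add, pow_succ (2 : ℝ≥0∞) N, mul_two]
      exact add_le_add (lintegral_branchVar_le ih' _ _ _) (lintegral_branchVar_le ih' _ _ _)

/-- The constant arises as `(3 + 4 * 3) / 3 = 5`: matching a bit costs a factor `4` in the weight.
-/
theorem lintegral_branchVar_sq_le {N : ℕ}
    (h : ∀ τ m, 4 ^ τ.length * ∫⁻ x, leafVar N τ m x ^ 2 ∂lebesgue 3 ≤ 3 * 4 ^ N)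
    (t : Fin 2) (τ : List (Fin 2)) (j : ℕ) :
    4 ^ (t :: τ).length * ∫⁻ x, branchVar N t τ j x ^ 2 ∂lebesgue 3 ≤ 5 * 4 ^ N := by
  have h1 := h (t :: τ) (j + 1)
  have h2 := h τ (j + 1)
  have e := lintegral_branchVar_sq N t τ j
  refine (ENNReal.mul_le_mul_iff_right (a := 3) (by simp) (by simp)).1 ?_
  calc (3 : ℝ≥0∞) * (4 ^ (t :: τ).length * ∫⁻ x, branchVar N t τ j x ^ 2 ∂lebesgue 3)
      = 4 ^ (t :: τ).length * ∫⁻ x, leafVar N (t :: τ) (j + 1) x ^ 2 ∂lebesgue 3 +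
        4 * (4 ^ τ.length * ∫⁻ x, leafVar N τ (j + 1) x ^ 2 ∂lebesgue 3) := by
        rw [mul_left_comm, e, mul_add, List.length_cons, pow_succ']
        ring
    _ ≤ 3 * 4 ^ N + 4 * (3 * 4 ^ N) := by gcongr
    _ = 3 * (5 * 4 ^ N) := by ring

/-- The second moment of the number of paths of length `N` along which `τ` is output. -/
theorem lintegral_leafVar_sq_le (N : ℕ) (τ : List (Fin 2)) (m : ℕ) :
    4 ^ τ.length * ∫⁻ x, leafVar N τ m x ^ 2 ∂lebesgue 3 ≤ 3 * 4 ^ N := by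
  have hnil : ∀ N m, 4 ^ ([] : List (Fin 2)).length * ∫⁻ x, leafVar N [] m x ^ 2 ∂lebesgue 3 ≤
      3 * 4 ^ N := by
    intro N m
    simp only [leafVar_nil, lintegral_const, measure_univ, mul_one, List.length_nil, pow_zero,
      one_mul]
    rw [← pow_mul, mul_comm N 2, pow_mul]
    norm_num
    exact le_mul_of_one_le_left zero_le (by norm_num)
  rcases τ with _ | ⟨t, τ⟩
  · exact hnil N m
  · induction N generalizing t τ m with
    | zero => simp [leafVar_zero_cons]
    | succ N ih =>
      have ih' : ∀ τ m, 4 ^ τ.length * ∫⁻ x, leafVar N τ m x ^ 2 ∂lebesgue 3 ≤ 3 * 4 ^ N := by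
        rintro (_ | ⟨t, τ⟩) m
        · exact hnil N m
        · exact ih m t τ
      have hm : ∀ j, Measurable (branchVar N t τ j) := fun j =>
        (measurable_branchVar N t τ j).mono (coordAlgebra_le _) le_rfl
      have hprod := lintegral_mul_of_disjoint (disjoint_labelsBelow m)
        (measurable_branchVar N t τ (2 * m)) (measurable_branchVar N t τ (2 * m + 1))
      have hAle := lintegral_branchVar_le (lintegral_leafVar_le N) t τ (2 * m)
      have hBle := lintegral_branchVar_le (lintegral_leafVar_le N) t τ (2 * m + 1)
      have hA2 := lintegral_branchVar_sq_le ih' t τ (2 * m)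
      have hB2 := lintegral_branchVar_sq_le ih' t τ (2 * m + 1)
      have hsum := leafVar_succ_cons N t τ m
      have hAm := hm (2 * m)
      have hBm := hm (2 * m + 1)
      generalize branchVar N t τ (2 * m) = A at *
      generalize branchVar N t τ (2 * m + 1) = B at *
      have e : ∫⁻ x, leafVar (N + 1) (t :: τ) m x ^ 2 ∂lebesgue 3 =
          ∫⁻ x, A x ^ 2 ∂lebesgue 3 + ∫⁻ x, B x ^ 2 ∂lebesgue 3 +
            2 * ((∫⁻ x, A x ∂lebesgue 3) * ∫⁻ x, B x ∂lebesgue 3) := by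
        rw [← hprod, ← lintegral_add_left (hAm.pow_const 2),
          ← lintegral_const_mul (f := fun x => A x * B x) 2 (hAm.mul hBm),
          ← lintegral_add_left (by fun_prop)]
        refine lintegral_congr fun x => ?_
        rw [hsum]
        ring
      have p : ∀ k : ℕ, (4 : ℝ≥0∞) ^ k = 2 ^ k * 2 ^ k := fun k => by
        rw [← mul_pow]; norm_num
      calc 4 ^ (t :: τ).length * ∫⁻ x, leafVar (N + 1) (t :: τ) m x ^ 2 ∂lebesgue 3
          = 4 ^ (t :: τ).length * ∫⁻ x, A x ^ 2 ∂lebesgue 3 +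
            4 ^ (t :: τ).length * ∫⁻ x, B x ^ 2 ∂lebesgue 3 +
            2 * ((2 ^ (t :: τ).length * ∫⁻ x, A x ∂lebesgue 3) *
              (2 ^ (t :: τ).length * ∫⁻ x, B x ∂lebesgue 3)) := by
            rw [e, mul_add, mul_add, p]; ring
        -- The constant `3` closes the induction exactly: two squares give `5` each, the independent
        -- cross term gives `2`, and `5 + 5 + 2 = 3 * 4`.
        _ ≤ 5 * 4 ^ N + 5 * 4 ^ N + 2 * (2 ^ N * 2 ^ N) := by
            gcongr
        _ = 3 * 4 ^ (N + 1) := by rw [← p]; ring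

/-! ### Computability of `leafCount` -/

/-- The child `j+1` of a node with remaining output `τ`, as a list with at most one element. -/
def childList (g : ℕ → Option (Fin 3)) (τ : List (Fin 2)) (j : ℕ) : List (ℕ × List (Fin 2)) :=
  ((advance (g j) τ).map (Prod.mk (j + 1))).toList

/-- One level of the breadth-first search through the nodes on the paths to which `τ` is output. -/
def expandLevel (g : ℕ → Option (Fin 3)) (L : List (ℕ × List (Fin 2))) :
    List (ℕ × List (Fin 2)) :=
  L.flatMap fun p => childList g p.2 (2 * p.1) ++ childList g p.2 (2 * p.1 + 1)

/-- The recursion of `leafCount` makes two calls with changed arguments. Counting the survivors of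
an iterated operation on lists is instead visibly primitive recursive. -/
theorem sum_leafCount_eq (g : ℕ → Option (Fin 3)) (N : ℕ) (L : List (ℕ × List (Fin 2))) :
    (L.map fun p => leafCount g N p.2 p.1).sum =
      (((expandLevel g)^[N] L).filter fun p => p.2 = []).length := by
  induction N generalizing L with
  | zero =>
    induction L with
    | nil => simp
    | cons p L ihL =>
      simp only [leafCount, Function.iterate_zero, id] at ihL ⊢
      rw [List.map_cons, List.sum_cons, ihL, List.filter_cons]
      by_cases h : p.2 = [] <;> simp [h, add_comm]
  | succ N ih =>
    have hc : ∀ (τ : List (Fin 2)) (j : ℕ),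
        ((childList g τ j).map fun p => leafCount g N p.2 p.1).sum =
          (advance (g j) τ).elim 0 fun τ' => leafCount g N τ' (j + 1) := by
      intro τ j
      rw [childList]
      rcases advance (g j) τ with _ | τ' <;> simp
    rw [Function.iterate_succ_apply, ← ih, expandLevel]
    induction L with
    | nil => simp
    | cons p L ihL =>
      rw [List.flatMap_cons, List.map_append, List.sum_append, ← ihL, List.map_append,
        List.sum_append, hc, hc]
      simp [leafCount]

theorem primrec_advance : Primrec₂ advance := by
  have h2 : PrimrecPred fun p : Option (Fin 3) × List (Fin 2) => p.1 = none :=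
    Primrec.eq.comp Primrec.fst (Primrec.const none)
  have h3 : PrimrecPred fun p : Option (Fin 3) × List (Fin 2) => p.1 = some 2 ∨ p.2 = [] :=
    (Primrec.eq.comp Primrec.fst (Primrec.const _)).or (Primrec.eq.comp Primrec.snd (Primrec.const _))
  have h4 : PrimrecPred fun p : Option (Fin 3) × List (Fin 2) =>
      p.2.head?.map Fin.castSucc = p.1 :=
    Primrec.eq.comp (Primrec.option_map (Primrec.list_head?.comp Primrec.snd)
      ((Primrec.dom_finite Fin.castSucc).comp₂ Primrec₂.right)) Primrec.fst
  exact Primrec.ite h2 (Primrec.const none) (Primrec.ite h3 (Primrec.option_some.comp Primrec.snd)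
    (Primrec.ite h4 (Primrec.option_some.comp (Primrec.list_tail.comp Primrec.snd))
      (Primrec.const none)))

theorem primrec_toList {α : Type*} [Primcodable α] : Primrec (Option.toList : Option α → List α) :=
  (Primrec.option_casesOn Primrec.id (Primrec.const [])
    (Primrec.list_cons.comp Primrec.snd (Primrec.const [])).to₂).of_eq fun o => by cases o <;> rfl

theorem primrec_childList : Primrec fun p : List (Fin 3) × List (Fin 2) × ℕ =>
    childList (fun i => p.1[i]?) p.2.1 p.2.2 :=
  primrec_toList.comp <| Primrec.option_map
    (primrec_advance.comp
      (Primrec.list_getElem?.comp Primrec.fst (Primrec.snd.comp Primrec.snd))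
      (Primrec.fst.comp Primrec.snd))
    (Primrec.pair (Primrec.succ.comp (Primrec.snd.comp (Primrec.snd.comp Primrec.fst)))
      Primrec.snd).to₂

theorem primrec_expandLevel : Primrec₂ fun (ρ : List (Fin 3)) (L : List (ℕ × List (Fin 2))) =>
    expandLevel (fun i => ρ[i]?) L := by
  have hj : Primrec fun a : (List (Fin 3) × List (ℕ × List (Fin 2))) × ℕ × List (Fin 2) =>
      2 * a.2.1 :=
    Primrec.nat_double.comp (Primrec.fst.comp Primrec.snd)
  have hρ : Primrec fun a : (List (Fin 3) × List (ℕ × List (Fin 2))) × ℕ × List (Fin 2) =>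
      a.1.1 := Primrec.fst.comp Primrec.fst
  have hτ : Primrec fun a : (List (Fin 3) × List (ℕ × List (Fin 2))) × ℕ × List (Fin 2) =>
      a.2.2 := Primrec.snd.comp Primrec.snd
  exact Primrec.list_flatMap Primrec.snd (Primrec.list_append.comp
    (primrec_childList.comp (Primrec.pair hρ (Primrec.pair hτ hj)))
    (primrec_childList.comp (Primrec.pair hρ (Primrec.pair hτ (Primrec.succ.comp hj))))).to₂

theorem primrec_leafCount : Primrec fun p : List (Fin 3) × ℕ × List (Fin 2) =>
    leafCount (fun i => p.1[i]?) p.2.1 p.2.2 0 := by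
  have h : Primrec fun p : List (Fin 3) × ℕ × List (Fin 2) =>
      (((expandLevel fun i => p.1[i]?)^[p.2.1] [(0, p.2.2)]).filter fun q => q.2 = []).length :=
    Primrec.list_length.comp <| (Primrec.listFilter
      (Primrec.eq.comp Primrec.snd (Primrec.const []))).comp <|
      Primrec.nat_iterate (Primrec.fst.comp Primrec.snd)
        (Primrec.list_cons.comp (Primrec.pair (Primrec.const 0) (Primrec.snd.comp Primrec.snd))
          (Primrec.const []))
        (primrec_expandLevel.comp (Primrec.fst.comp Primrec.fst) Primrec.snd).to₂
  refine h.of_eq fun p => ?_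
  rw [← sum_leafCount_eq]
  simp

theorem primrec_two_pow : Primrec fun n : ℕ => 2 ^ n :=
  (Primrec.nat_iterate Primrec.id (Primrec.const 1)
    (Primrec.nat_double.comp Primrec.snd).to₂).of_eq fun n => by
      induction n with
      | zero => rfl
      | succ n ih => rw [id, Function.iterate_succ_apply', pow_succ', ← ih]; rfl

/-- Unbounded search through the codes of elements of `β`. Numbers that code nothing stand for
`default`, which is a genuine candidate, so no false witness arises. -/
theorem rePred_exists {α β : Type*} [Primcodable α] [Primcodable β] [Inhabited β]
    {P : α → β → Prop} (h : PrimrecRel P) : REPred fun a => ∃ b, P a b := by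
  classical
  have h' : ComputablePred fun p : α × ℕ => P p.1 ((Encodable.decode (α := β) p.2).getD default) :=
    PrimrecPred.computablePred <| PrimrecRel.comp h Primrec.fst <|
      Primrec.option_getD.comp (Primrec.decode.comp Primrec.snd) (Primrec.const default)
  have hp : Partrec fun a : α => Nat.rfind fun n =>
      (Part.some (decide (P a ((Encodable.decode (α := β) n).getD default))) : Part Bool) :=
    Partrec.rfind h'.decide.partrec
  refine hp.dom_re.of_eq fun a => ?_
  refine (Nat.rfind_dom (p := fun n => Part.some (decide _))).trans ?_
  constructor
  · rintro ⟨n, hn, -⟩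
    exact ⟨_, by simpa using hn⟩
  · rintro ⟨b, hb⟩
    exact ⟨Encodable.encode b, by simpa using hb, fun _ => trivial⟩

/-- Some `σ` of length `3i+2` is output along at least the fraction `2^{-i}` of the paths of some
length. -/
def HasHeavyString (g : ℕ → Option (Fin 3)) (i : ℕ) : Prop :=
  ∃ q : ℕ × List (Fin 2), q.2.length = 3 * i + 2 ∧ 2 ^ q.1 ≤ 2 ^ i * leafCount g q.1 q.2 0

theorem rePred_hasHeavyString (k : ℕ) : REPred fun p : ℕ × List (Fin 3) =>
    HasHeavyString (fun j => p.2[j]?) (p.1 + k) := by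
  have hi : Primrec fun a : (ℕ × List (Fin 3)) × ℕ × List (Fin 2) => a.1.1 + k :=
    Primrec.nat_add.comp (Primrec.fst.comp Primrec.fst) (Primrec.const k)
  have h1 : PrimrecPred fun a : (ℕ × List (Fin 3)) × ℕ × List (Fin 2) =>
      a.2.2.length = 3 * (a.1.1 + k) + 2 :=
    Primrec.eq.comp (Primrec.list_length.comp (Primrec.snd.comp Primrec.snd))
      (Primrec.nat_add.comp (Primrec.nat_mul.comp (Primrec.const 3) hi) (Primrec.const 2))
  have h2 : PrimrecPred fun a : (ℕ × List (Fin 3)) × ℕ × List (Fin 2) =>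
      2 ^ a.2.1 ≤ 2 ^ (a.1.1 + k) * leafCount (fun j => a.1.2[j]?) a.2.1 a.2.2 0 :=
    Primrec.nat_le.comp (primrec_two_pow.comp (Primrec.fst.comp Primrec.snd))
      (Primrec.nat_mul.comp (primrec_two_pow.comp hi)
        (primrec_leafCount.comp (Primrec.pair (Primrec.snd.comp Primrec.fst) Primrec.snd)))
  exact rePred_exists (h1.and h2)

/-! ### The Martin-Löf test -/

/-- The labellings for which some string of length `3i+2` is output with probability about
`2^{-i}` or more. -/
def heavySet (i : ℕ) : Set (SeqSpace 3) := {x | HasHeavyString (fun j => some (x j)) i}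

/-- Markov's inequality for the square of `leafVar`. -/
theorem lebesgue_leafVar_ge_le (i N : ℕ) (τ : List (Fin 2)) (m : ℕ) :
    4 ^ τ.length * lebesgue 3 {x | 2 ^ N ≤ 2 ^ i * leafVar N τ m x} ≤ 3 * 4 ^ i := by
  have hm : Measurable (leafVar N τ m) := (measurable_leafVar N τ m).mono (coordAlgebra_le _) le_rfl
  have p : ∀ k : ℕ, (4 : ℝ≥0∞) ^ k = (2 ^ k) ^ 2 := fun k => by
    rw [← pow_mul, mul_comm, pow_mul]; norm_num
  have hsub : {x | 2 ^ N ≤ 2 ^ i * leafVar N τ m x} ⊆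
      {x | 4 ^ N ≤ 4 ^ i * leafVar N τ m x ^ 2} := by
    intro x (hx : 2 ^ N ≤ 2 ^ i * leafVar N τ m x)
    change (4 : ℝ≥0∞) ^ N ≤ 4 ^ i * leafVar N τ m x ^ 2
    rw [p, p, ← mul_pow]
    gcongr
  have hmarkov := mul_meas_ge_le_lintegral (μ := lebesgue 3)
    (f := fun x => 4 ^ i * leafVar N τ m x ^ 2) (by fun_prop) (4 ^ N)
  rw [lintegral_const_mul _ (by fun_prop)] at hmarkov
  have h2 := lintegral_leafVar_sq_le N τ m
  refine (ENNReal.mul_le_mul_iff_right (a := 4 ^ N) (by simp) (by simp)).1 ?_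
  calc (4 : ℝ≥0∞) ^ N * (4 ^ τ.length * lebesgue 3 {x | 2 ^ N ≤ 2 ^ i * leafVar N τ m x})
      ≤ 4 ^ τ.length * (4 ^ N * lebesgue 3 {x | 4 ^ N ≤ 4 ^ i * leafVar N τ m x ^ 2}) := by
        rw [mul_left_comm]
        gcongr
    _ ≤ 4 ^ τ.length * (4 ^ i * ∫⁻ x, leafVar N τ m x ^ 2 ∂lebesgue 3) := by gcongr
    _ = 4 ^ i * (4 ^ τ.length * ∫⁻ x, leafVar N τ m x ^ 2 ∂lebesgue 3) := mul_left_comm _ _ _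
    _ ≤ 4 ^ i * (3 * 4 ^ N) := by gcongr
    _ = 4 ^ N * (3 * 4 ^ i) := by ring

theorem lebesgue_exists_leafVar_ge_le (i n N : ℕ) :
    2 ^ n * lebesgue 3 {x | ∃ σ : List (Fin 2), σ.length = n ∧ 2 ^ N ≤ 2 ^ i * leafVar N σ 0 x} ≤
      3 * 4 ^ i := by
  have hsub : {x | ∃ σ : List (Fin 2), σ.length = n ∧ 2 ^ N ≤ 2 ^ i * leafVar N σ 0 x} ⊆
      ⋃ v : Fin n → Fin 2, {x | 2 ^ N ≤ 2 ^ i * leafVar N (List.ofFn v) 0 x} := by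
    rintro x ⟨σ, rfl, hx⟩
    refine Set.mem_iUnion.2 ⟨σ.get, ?_⟩
    rw [List.ofFn_get]
    exact hx
  have p : (4 : ℝ≥0∞) ^ n = 2 ^ n * 2 ^ n := by rw [← mul_pow]; norm_num
  -- Each single string has a bound with weight `4 ^ n`; one factor `2 ^ n` pays for the number of
  -- strings.
  refine (ENNReal.mul_le_mul_iff_right (a := 2 ^ n) (by simp) (by simp)).1 ?_
  rw [← mul_assoc, ← p]
  calc _ ≤ (4 : ℝ≥0∞) ^ n * ∑ v : Fin n → Fin 2,
        lebesgue 3 {x | 2 ^ N ≤ 2 ^ i * leafVar N (List.ofFn v) 0 x} := by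
        gcongr
        exact (measure_mono hsub).trans (measure_iUnion_fintype_le _ _)
    _ ≤ ∑ v : Fin n → Fin 2, 3 * 4 ^ i := by
        rw [Finset.mul_sum]
        refine Finset.sum_le_sum fun v _ => ?_
        have := lebesgue_leafVar_ge_le i N (List.ofFn v) 0
        rwa [List.length_ofFn] at this
    _ = 2 ^ n * (3 * 4 ^ i) := by simp

theorem lebesgue_heavySet_le (i : ℕ) : lebesgue 3 (heavySet i) ≤ 2⁻¹ ^ i := by
  set V : ℕ → Set (SeqSpace 3) := fun N =>
    {x | ∃ σ : List (Fin 2), σ.length = 3 * i + 2 ∧ 2 ^ N ≤ 2 ^ i * leafVar N σ 0 x} with hV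
  have hcast : ∀ N σ x, ((2 : ℝ≥0∞) ^ N ≤ 2 ^ i * leafVar N σ 0 x ↔
      2 ^ N ≤ 2 ^ i * leafCount (fun j => some (x j)) N σ 0) := by
    intro N σ x
    rw [leafVar]
    exact_mod_cast Iff.rfl
  have hU : heavySet i = ⋃ N, V N := by
    ext x
    simp only [heavySet, HasHeavyString, Prod.exists, hV, Set.mem_iUnion, Set.mem_ofPred_eq, hcast]
  -- Monotonicity replaces a sum over `N` by a supremum, so that a bound uniform in `N` is enough.
  have hmono : Monotone V := by
    refine monotone_nat_of_le_succ fun N => ?_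
    rintro x ⟨σ, hσ, hx⟩
    refine ⟨σ, hσ, ?_⟩
    rw [hcast] at hx ⊢
    have := Nat.mul_le_mul_left (2 ^ i) (two_mul_leafCount_le x N σ 0)
    rw [pow_succ]
    linarith
  rw [hU, hmono.measure_iUnion]
  refine iSup_le fun N => ?_
  rw [← ENNReal.inv_pow, ENNReal.le_inv_iff_mul_le]
  have h := lebesgue_exists_leafVar_ge_le i (3 * i + 2) N
  -- This factor times `2 ^ i` is `2 ^ (3 * i + 2)`; the length of `σ` was chosen so that only `3 ≤
  -- 4` remains to be checked.
  refine (ENNReal.mul_le_mul_iff_right (a := 4 * 4 ^ i) (by simp) (by finiteness)).1 ?_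
  have p : (2 : ℝ≥0∞) ^ (3 * i + 2) = 4 * 4 ^ i * 2 ^ i := by
    rw [pow_add, pow_mul, mul_assoc, ← mul_pow, mul_comm]; norm_num
  calc 4 * 4 ^ i * (lebesgue 3 (V N) * 2 ^ i) = 2 ^ (3 * i + 2) * lebesgue 3 (V N) := by
        rw [p]; ring
    _ ≤ 3 * 4 ^ i := h
    _ ≤ 4 * 4 ^ i * 1 := by
        rw [mul_one]
        gcongr
        norm_num

theorem initSeg_getElem?_eq {n : ℕ} (x : SeqSpace n) {k j : ℕ} (h : j < k) :
    (initSeg x k)[j]? = some (x j) := by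
  simp [initSeg, h]

/-- Membership is witnessed by one finite `N`, hence by finitely many labels. Conversely, labels
missing from `ρ` count as failures, so knowing more labels can only raise the count. -/
theorem heavySet_eq (i : ℕ) :
    heavySet i = {x | ∃ ρ, HasHeavyString (fun j => ρ[j]?) i ∧ x ∈ cylinder ρ} := by
  ext x
  constructor
  · rintro ⟨⟨N, σ⟩, hσ, h⟩
    refine ⟨initSeg x (2 ^ N * 2), ⟨⟨N, σ⟩, hσ, ?_⟩, ?_⟩
    · rwa [leafCount_congr (g' := fun j => some (x j)) N σ 0]
      intro j hj
      exact initSeg_getElem?_eq x (by omega)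
    · simp [cylinder, initSeg]
  · rintro ⟨ρ, ⟨⟨N, σ⟩, hσ, h⟩, hx⟩
    refine ⟨⟨N, σ⟩, hσ, h.trans (Nat.mul_le_mul_left _ (leafCount_mono ?_ N σ 0))⟩
    intro j c hj
    obtain ⟨hlt, -⟩ := List.getElem?_eq_some_iff.1 hj
    rw [← hj, ← initSeg_getElem?_eq x hlt]
    exact congrArg (fun l : List (Fin 3) => l[j]?) hx

theorem isMLTest_heavySet (k : ℕ) : IsMLTest (lebesgue 3) fun i => heavySet (i + k) := by
  refine ⟨⟨fun p => HasHeavyString (fun j => p.2[j]?) (p.1 + k), rePred_hasHeavyString k,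
    fun i => heavySet_eq _⟩, fun i => (lebesgue_heavySet_le _).trans ?_⟩
  rw [pow_add]
  exact mul_le_of_le_one_right' (pow_le_one₀ zero_le (by simp))

/-! ### Fibres of the coded function -/

/-- What remains of `τ` after reading `N` labels of the sequence `a` from the position `k` on. -/
def readLabels (a : ℕ → Fin 3) : ℕ → ℕ → List (Fin 2) → Option (List (Fin 2))
  | 0, _, τ => some τ
  | N + 1, k, τ => (advance (some (a k)) τ).bind (readLabels a N (k + 1))

/-- The definition peels off the first label; induction along a path needs to peel off the last. -/
theorem readLabels_succ (a : ℕ → Fin 3) (N k : ℕ) (τ : List (Fin 2)) :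
    readLabels a (N + 1) k τ = (readLabels a N k τ).bind (advance (some (a (k + N)))) := by
  induction N generalizing k τ with
  | zero => simp [readLabels]
  | succ N ih =>
    rw [readLabels, readLabels, Option.bind_assoc]
    congr 1
    funext τ'
    rw [ih, show k + 1 + N = k + (N + 1) by ring]

theorem readLabels_drop {a : ℕ → Fin 3} {z : SeqSpace 2}
    (h : ∀ j, a (Nat.nth (fun k => a k ≠ 2) j) = (z j).castSucc) (n N : ℕ) :
    readLabels a N 0 (initSeg z n) =
      some ((initSeg z n).drop (Nat.count (fun k => a k ≠ 2) N)) := by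
  induction N with
  | zero => simp [readLabels]
  | succ N ih =>
    rw [readLabels_succ, ih, Option.bind_some, zero_add, Nat.count_succ]
    by_cases hN : a N = 2
    · simp [hN, advance_two]
    · have hz := h (Nat.count (fun k => a k ≠ 2) N)
      rw [Nat.nth_count (p := fun k => a k ≠ 2) hN] at hz
      rw [if_pos hN]
      set c := Nat.count (fun k => a k ≠ 2) N
      by_cases hc : c < n
      · have hl : c < (initSeg z n).length := by simpa [initSeg] using hc
        rw [List.drop_eq_getElem_cons hl, advance_cons, if_neg hN]
        simp [initSeg, hz]
      · rw [List.drop_eq_nil_of_le (by simp [initSeg]; omega),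
          List.drop_eq_nil_of_le (by simp [initSeg]; omega), advance_nil]

theorem initSeg_succ {n : ℕ} (y : SeqSpace n) (k : ℕ) :
    initSeg y (k + 1) = initSeg y k ++ [y k] := by
  rw [initSeg, List.ofFn_succ_last]
  rfl

/-- Splitting `cylinder s` by the next bit mirrors the recursion of `leafCount`: each successful
node is a string of length `s.length + N`, whose cylinder has measure `2⁻¹ ^ (s.length + N)`. -/
theorem lebesgue_readLabels_le (x : SeqSpace 3) (N : ℕ) (s τ : List (Fin 2)) :
    lebesgue 2 {y | y ∈ cylinder s ∧ readLabels (labelsAlong x y) N s.length τ = some []} ≤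
      leafCount (fun i => some (x i)) N τ (strIndex s) * 2⁻¹ ^ (s.length + N) := by
  induction N generalizing s τ with
  | zero =>
    rcases τ with _ | ⟨t, τ⟩
    · simpa [readLabels, leafCount] using (lebesgue_cylinder 2 s).le
    · simp [readLabels]
  | succ N ih =>
    have key : ∀ b : Fin 2, lebesgue 2 {y | (y ∈ cylinder s ∧
          readLabels (labelsAlong x y) (N + 1) s.length τ = some []) ∧ y s.length = b} ≤
        (((advance (some (x (2 * strIndex s + b))) τ).elim 0 fun τ' =>
          leafCount (fun i => some (x i)) N τ' (2 * strIndex s + b + 1) : ℕ) : ℝ≥0∞) *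
            2⁻¹ ^ (s.length + (N + 1)) := by
      intro b
      have hlab : ∀ y, y ∈ cylinder s → y s.length = b →
          initSeg y (s.length + 1) = s ++ [b] ∧
            labelsAlong x y s.length = x (2 * strIndex s + b) := by
        intro y (hy : initSeg y s.length = s) hb
        have h1 : initSeg y (s.length + 1) = s ++ [b] := by rw [initSeg_succ, hy, hb]
        refine ⟨h1, ?_⟩
        rw [labelsAlong, h1, label, strIndex_concat]
        congr 1
        omega
      rcases hadv : advance (some (x (2 * strIndex s + b))) τ with _ | τ'
      · refine (measure_mono_null (t := ∅) ?_ measure_empty).le.trans zero_le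
        rintro y ⟨⟨hy, hr⟩, hb⟩
        rw [readLabels, (hlab y hy hb).2, hadv] at hr
        simp at hr
      · refine (measure_mono ?_).trans ((ih (s ++ [b]) τ').trans_eq ?_)
        · rintro y ⟨⟨hy, hr⟩, hb⟩
          rw [readLabels, (hlab y hy hb).2, hadv] at hr
          refine ⟨?_, ?_⟩
          · simpa [cylinder] using (hlab y hy hb).1
          · simpa using hr
        · rw [strIndex_concat, List.length_append, List.length_singleton, Option.elim_some,
            add_right_comm (2 * strIndex s), add_assoc s.length, add_comm 1 N]
    have hsub : {y | y ∈ cylinder s ∧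
        readLabels (labelsAlong x y) (N + 1) s.length τ = some []} ⊆
        {y | (y ∈ cylinder s ∧
          readLabels (labelsAlong x y) (N + 1) s.length τ = some []) ∧ y s.length = 0} ∪
        {y | (y ∈ cylinder s ∧
          readLabels (labelsAlong x y) (N + 1) s.length τ = some []) ∧ y s.length = 1} := by
      intro y hy
      have : y s.length = 0 ∨ y s.length = 1 := by omega
      exact this.imp (fun h => ⟨hy, h⟩) fun h => ⟨hy, h⟩
    refine (measure_mono hsub).trans ((measure_union_le _ _).trans
      ((add_le_add (key 0) (key 1)).trans_eq ?_))
    rw [← add_mul, ← Nat.cast_add]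
    rfl

theorem preimage_codedFunction_subset (x : SeqSpace 3) (z : SeqSpace 2) (n : ℕ) :
    (codedFunction x).preimage {z} ⊆ ⋃ N, {y | y ∈ cylinder [] ∧
      readLabels (labelsAlong x y) N 0 (initSeg z n) = some []} := by
  intro y hy
  obtain ⟨z', rfl, hinf, hz⟩ := (PFun.mem_preimage _ _ _).1 hy
  have hinf' : {k | labelsAlong x y k ≠ 2}.Infinite := hinf
  have hj : ∀ j, labelsAlong x y (Nat.nth (fun k => labelsAlong x y k ≠ 2) j) =
      (z' j).castSucc := by
    intro j
    rw [← hz]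
    exact (Fin.castSucc_castPred _ (Nat.nth_mem_of_infinite hinf' j)).symm
  -- Exactly `n` labels other than `2` precede the position of the one numbered `n` from `0`.
  refine Set.mem_iUnion.2 ⟨Nat.nth (fun k => labelsAlong x y k ≠ 2) n, rfl, ?_⟩
  rw [readLabels_drop hj, Nat.count_nth_of_infinite hinf',
    List.drop_eq_nil_of_le (by simp [initSeg])]

theorem monotone_readLabels (x : SeqSpace 3) (τ : List (Fin 2)) :
    Monotone fun N => {y : SeqSpace 2 | y ∈ cylinder [] ∧
      readLabels (labelsAlong x y) N 0 τ = some []} := by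
  refine monotone_nat_of_le_succ fun N => ?_
  rintro y ⟨h, hy⟩
  exact ⟨h, by rw [readLabels_succ, hy, Option.bind_some, advance_nil]⟩

/-- If `F_x` has a fibre of measure more than `2^{-i}`, then `x` is in `heavySet i`. -/
theorem mem_heavySet_of_lt (x : SeqSpace 3) (z : SeqSpace 2) (i : ℕ)
    (h : 2⁻¹ ^ i < lebesgue 2 ((codedFunction x).preimage {z})) : x ∈ heavySet i := by
  have h' := h.trans_le (measure_mono (preimage_codedFunction_subset x z (3 * i + 2)))
  -- The measure of the increasing union is a supremum, so some finite `N` already exceeds `2⁻¹ ^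
  -- i`.
  rw [(monotone_readLabels x _).measure_iUnion] at h'
  obtain ⟨N, hN⟩ := lt_iSup_iff.1 h'
  refine ⟨(N, initSeg z (3 * i + 2)), by simp [initSeg], ?_⟩
  have hle := hN.trans_le (lebesgue_readLabels_le x N [] (initSeg z (3 * i + 2)))
  rw [strIndex_nil, List.length_nil, zero_add, ← ENNReal.inv_pow, ← ENNReal.inv_pow,
    ← div_eq_mul_inv, ENNReal.lt_div_iff_mul_lt (by simp) (by simp), mul_comm,
    ← div_eq_mul_inv, ENNReal.div_lt_iff (by simp) (by simp), mul_comm] at hle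
  exact_mod_cast hle.le

end RandomContinuous

theorem mainTheorem11 (F : RandomContinuous.SeqSpace 2 →. RandomContinuous.SeqSpace 2)
    (hF : RandomContinuous.IsRandomContinuousFunction F) :
    ∀ z : RandomContinuous.SeqSpace 2, RandomContinuous.inducedMeasure F {z} = 0 := by
  intro z
  obtain ⟨x, hx, rfl⟩ := hF
  rw [RandomContinuous.inducedMeasure_codedFunction_apply x (MeasurableSet.singleton z)]
  by_contra hne
  -- The fibre has measure above `2⁻¹ ^ k`, so `x` lies in `heavySet i` for all `i ≥ k`; the test is
  -- shifted by `k` to skip the earlier levels.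
  obtain ⟨k, hk⟩ := ENNReal.exists_inv_two_pow_lt hne
  refine hx _ (RandomContinuous.isMLTest_heavySet k) (Set.mem_iInter.2 fun i => ?_)
  refine RandomContinuous.mem_heavySet_of_lt x z (i + k) (lt_of_le_of_lt ?_ hk)
  rw [pow_add]
  exact mul_le_of_le_one_left' (pow_le_one₀ zero_le (by simp))
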